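/- Let $a>0$, $b<0$ be real and let $\alpha$ be real with $\alpha^2=b^2/16$. Put $T=-a/b>0$. Write $z=\frac{x_1+ix_2}{2}$, $\partial_z=\partial_{x_1}-i\partial_{x_2}$, $\partial_{\bar z}=\partial_{x_1}+i\partial_{x_2}$ (so $\partial_z\partial_{\bar z}=\Delta$), let $\mathbf H^2=\{s\in\mathbf R^3: s_1^2+s_2^2-s_3^2=-1,\ s_3<0\}$, and identify $s\in\mathbf H^2$ with the matrix $S=\begin{pmatrix} is_3 & s_1+is_2\\ s_1-is_2 & -is_3\end{pmatrix}\in su(1,1)$. Then there is a $C^\infty$ map $S:(-\infty,T)\times\mathbf R^2\to\mathbf H^2$ which solves the Schr\"odinger map equation $$S_t=-\tfrac12[S,S_{z\bar z}]\qquad\text{on }(-\infty,T)\times\mathbf R^2$$ and whose gradient $|\nabla S|=\sum_{j=1}^3\big(|(s_j)_z|+|(s_j)_{\bar z}|\big)$ tends to $+\infty$ as $t\uparrow T=-a/b$ at every point of the plane except the origin, and does not tend to $+\infty$ at the origin. Moreover $S=-iG\sigma_3G^{-1}$, with $\sigma_3=\mathrm{diag}(1,-1)$, for a $C^\infty$ map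 $G:(-\infty,T)\times\mathbf R^2\to SU(1,1)$ satisfying $$G_z=-G\begin{pmatrix}0&q\\ r&0\end{pmatrix},\qquad G_{\bar z}=G\begin{pmatrix}0&-\bar r\\ -\bar q&0\end{pmatrix},\qquad G_t=iG\begin{pmatrix}u&-q_{\bar z}\\ r_{\bar z}&-u\end{pmatrix},$$ where $$q=\frac{e^{\frac{ibz\bar z}{2(a+bt)}}}{a+bt}\,\alpha\bar z,\qquad r=\frac{e^{-\frac{ibz\bar z}{2(a+bt)}}}{a+bt}\,\alpha\bar z,\qquad u=\frac{2\alpha^2z\bar z}{(a+bt)^2},$$ and $|q|+|r|\le|\nabla S|$ holds on $(-\infty,T)\times\mathbf R^2$. -/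

import Mathlib

open Filter Topology Set
open scoped ContDiff

noncomputable section

/-- The sheet `s₃ < 0` of the hyperboloid `s₁² + s₂² - s₃² = -1` in Minkowski 3-space; a model of
the hyperbolic plane. -/
def hyperbolicPlane : Set (Fin 3 → ℝ) :=
  {s | s 0 ^ 2 + s 1 ^ 2 - s 2 ^ 2 = -1 ∧ s 2 < 0}

/-- `∂/∂z = ∂/∂x₁ - i ∂/∂x₂`, for the complex coordinate `z = (x₁ + i x₂) / 2`. -/
def dz (f : ℝ → ℝ → ℂ) (x y : ℝ) : ℂ :=
  deriv (fun x' => f x' y) x - Complex.I * deriv (fun y' => f x y') y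

/-- `∂/∂z̄ = ∂/∂x₁ + i ∂/∂x₂`, for the complex coordinate `z = (x₁ + i x₂) / 2`. -/
def dzbar (f : ℝ → ℝ → ℂ) (x y : ℝ) : ℂ :=
  deriv (fun x' => f x' y) x + Complex.I * deriv (fun y' => f x y') y

/-- Entrywise `∂/∂z` of a matrix valued function. -/
def matDz (F : ℝ → ℝ → Matrix (Fin 2) (Fin 2) ℂ) (x y : ℝ) : Matrix (Fin 2) (Fin 2) ℂ :=
  Matrix.of fun j k => dz (fun x' y' => F x' y' j k) x y

/-- Entrywise `∂/∂z̄` of a matrix valued function. -/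
def matDzbar (F : ℝ → ℝ → Matrix (Fin 2) (Fin 2) ℂ) (x y : ℝ) : Matrix (Fin 2) (Fin 2) ℂ :=
  Matrix.of fun j k => dzbar (fun x' y' => F x' y' j k) x y

/-- Entrywise `∂/∂t` of a matrix valued function. -/
def matDt (F : ℝ → ℝ → ℝ → Matrix (Fin 2) (Fin 2) ℂ) (t x y : ℝ) : Matrix (Fin 2) (Fin 2) ℂ :=
  Matrix.of fun j k => deriv (fun t' => F t' x y j k) t

/-- The matrix in `su(1,1)` of a vector `(s₁, s₂, s₃)`. -/
def spinMatrix (s : Fin 3 → ℝ) : Matrix (Fin 2) (Fin 2) ℂ :=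
  !![Complex.I * (s 2 : ℂ), (s 0 : ℂ) + Complex.I * (s 1 : ℂ);
     (s 0 : ℂ) - Complex.I * (s 1 : ℂ), -(Complex.I * (s 2 : ℂ))]

/-- `s = s(t, x₁, x₂)` is a `C^∞` Schrödinger map from the plane to the hyperbolic plane for times
in the open set `J`: it is smooth on `J × ℝ²`, takes values in the hyperboloid, and its matrix
`S` satisfies `S_t = -½ [S, S_{z z̄}]`. -/
structure IsSmoothSchrodingerMap (J : Set ℝ) (s : ℝ → ℝ → ℝ → Fin 3 → ℝ) : Prop where
  smooth : ContDiffOn ℝ ∞ (fun w : ℝ × ℝ × ℝ => s w.1 w.2.1 w.2.2) (J ×ˢ univ)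
  mem : ∀ t ∈ J, ∀ x y : ℝ, s t x y ∈ hyperbolicPlane
  eqn : ∀ t ∈ J, ∀ x y : ℝ,
    matDt (fun t' x' y' => spinMatrix (s t' x' y')) t x y =
      -(1 / 2 : ℂ) •
        (spinMatrix (s t x y) *
            matDz (matDzbar fun x' y' => spinMatrix (s t x' y')) x y -
          matDz (matDzbar fun x' y' => spinMatrix (s t x' y')) x y *
            spinMatrix (s t x y))

/-- The length of the spatial gradient at a point,
`|∇S| = ∑ⱼ (|(sⱼ)_z| + |(sⱼ)_z̄|)`. -/
def gradSize (s : ℝ → ℝ → Fin 3 → ℝ) (x y : ℝ) : ℝ :=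
  ∑ j : Fin 3, (‖dz (fun x' y' => (s x' y' j : ℂ)) x y‖ +
    ‖dzbar (fun x' y' => (s x' y' j : ℂ)) x y‖)

/-- The Pauli matrix `σ₃`. -/
def sigma3 : Matrix (Fin 2) (Fin 2) ℂ := !![1, 0; 0, -1]

/-- The group `SU(1,1)`. -/
def SU11 : Set (Matrix (Fin 2) (Fin 2) ℂ) :=
  {G | G.conjTranspose * sigma3 * G = sigma3 ∧ G.det = 1}

/-- `G` is a smooth `SU(1,1)`-valued gauge which transforms `(p, q, r, u)` into `s` on `J × ℝ²`:
it solves the linear system with coefficients `(p, q, r, u)`, and `S = -i G σ₃ G⁻¹`. -/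
structure IsGaugeTransform (J : Set ℝ) (p q r : ℝ → ℝ → ℝ → ℂ) (u : ℝ → ℝ → ℝ → ℝ)
    (G : ℝ → ℝ → ℝ → Matrix (Fin 2) (Fin 2) ℂ) (s : ℝ → ℝ → ℝ → Fin 3 → ℝ) : Prop where
  smooth : ∀ j k : Fin 2,
    ContDiffOn ℝ ∞ (fun w : ℝ × ℝ × ℝ => G w.1 w.2.1 w.2.2 j k) (J ×ˢ univ)
  mem : ∀ t ∈ J, ∀ x y : ℝ, G t x y ∈ SU11
  eqn_z : ∀ t ∈ J, ∀ x y : ℝ,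
    matDz (G t) x y = -(G t x y * !![p t x y, q t x y; r t x y, -p t x y])
  eqn_zbar : ∀ t ∈ J, ∀ x y : ℝ,
    matDzbar (G t) x y = G t x y *
      !![star (p t x y), -star (r t x y); -star (q t x y), -star (p t x y)]
  eqn_t : ∀ t ∈ J, ∀ x y : ℝ,
    matDt G t x y = G t x y *
      !![Complex.I * (u t x y : ℂ),
          -(Complex.I * (dzbar (q t) x y + 2 * star (p t x y) * q t x y));
        Complex.I * (dzbar (r t) x y - 2 * star (p t x y) * r t x y),
          -(Complex.I * (u t x y : ℂ))]
  spin_eq : ∀ t ∈ J, ∀ x y : ℝ,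
    spinMatrix (s t x y) = -(Complex.I • (G t x y * sigma3 * (G t x y)⁻¹))

/-- The complex coordinate `z = (x₁ + i x₂) / 2`. -/
def zc (x y : ℝ) : ℂ := ((x : ℂ) + Complex.I * (y : ℂ)) / 2

/-- `q = exp(i b z z̄ / (2(a+bt))) α z̄ / (a+bt)`. -/
def qExplicit (a b α t x y : ℝ) : ℂ :=
  Complex.exp (Complex.I * (b * zc x y * star (zc x y) / (2 * (a + b * t)))) / (a + b * t) *
    α * star (zc x y)

/-- `r = exp(-i b z z̄ / (2(a+bt))) α z̄ / (a+bt)`. -/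
def rExplicit (a b α t x y : ℝ) : ℂ :=
  Complex.exp (-(Complex.I * (b * zc x y * star (zc x y) / (2 * (a + b * t))))) / (a + b * t) *
    α * star (zc x y)

/-- `u = 2 α² z z̄ / (a+bt)²`. -/
def uExplicit (a b α t x y : ℝ) : ℝ :=
  2 * α ^ 2 * ‖zc x y‖ ^ 2 / (a + b * t) ^ 2

end

/-! A matrix in `SU(1,1)` is determined by its first row `(P, Q)`, where `|P|² - |Q|² = 1`, and
the point of the hyperbolic plane that it represents is `s₁ + i s₂ = 2iPQ`, `s₃ = -(|P|² + |Q|²)`.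
When `(P, Q)` solves the linear system with `p = 0` and `r_z̄ = conj q_z̄`, differentiating these
products shows that `s` is a Schrödinger map. Its gradient is bounded below: for
`w = s₁ + i s₂`,

  `w_z = -2i (q P² + r Q²)`,  `w_z̄ = -2i (r̄ P² + q̄ Q²)`,

so `|P|² - |Q|² = 1` gives `|q| + |r| ≤ |w_z| + |w_z̄| ≤ |∇S|`. Thus `∇S` blows up wherever `q`
does, while at the origin `q = r = 0` forces `∇S = 0` for all times.

For the explicit `q` and `r`, the linear system is an ordinary differential equation in the phase
`κ = b z z̄ / (4 (a + bt))`. After the oscillating factors `e^{∓iκ}` of `P` and `Q` are removed it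
has constant coefficients, and `α² = b² / 16` makes its matrix nilpotent, so that its solutions
are linear functions of `κ`.
-/

section

open Complex

/-- The partial derivatives of `f` at `(x, y)` exist, with `∂f/∂z = fz` and `∂f/∂z̄ = fzb` in the
normalisation of `dz` and `dzbar`. It has a calculus free of differentiability side goals. -/
structure HasWirtingerDerivAt (f : ℝ → ℝ → ℂ) (fz fzb : ℂ) (x y : ℝ) : Prop where
  left : HasDerivAt (fun x' => f x' y) ((fz + fzb) / 2) x
  right : HasDerivAt (fun y' => f x y') (I * (fz - fzb) / 2) y

namespace HasWirtingerDerivAt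

variable {f g : ℝ → ℝ → ℂ} {fz fzb gz gzb : ℂ} {x y : ℝ}

theorem dz_eq (hf : HasWirtingerDerivAt f fz fzb x y) : dz f x y = fz := by
  rw [dz, hf.left.deriv, hf.right.deriv]
  linear_combination (fzb - fz) / 2 * I_sq

theorem dzbar_eq (hf : HasWirtingerDerivAt f fz fzb x y) : dzbar f x y = fzb := by
  rw [dzbar, hf.left.deriv, hf.right.deriv]
  linear_combination (fz - fzb) / 2 * I_sq

theorem hasWirtingerDerivAt_dz_dzbar (hf : HasWirtingerDerivAt f fz fzb x y) :
    HasWirtingerDerivAt f (dz f x y) (dzbar f x y) x y := by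
  rwa [hf.dz_eq, hf.dzbar_eq]

theorem congr_deriv {fz' fzb' : ℂ} (hf : HasWirtingerDerivAt f fz fzb x y) (hz : fz = fz')
    (hzb : fzb = fzb') : HasWirtingerDerivAt f fz' fzb' x y :=
  hz ▸ hzb ▸ hf

theorem const (c : ℂ) (x y : ℝ) : HasWirtingerDerivAt (fun _ _ => c) 0 0 x y :=
  ⟨by simpa using hasDerivAt_const x c, by simpa using hasDerivAt_const y c⟩

theorem add (hf : HasWirtingerDerivAt f fz fzb x y) (hg : HasWirtingerDerivAt g gz gzb x y) :
    HasWirtingerDerivAt (fun x' y' => f x' y' + g x' y') (fz + gz) (fzb + gzb) x y :=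
  ⟨(hf.left.add hg.left).congr_deriv (by ring), (hf.right.add hg.right).congr_deriv (by ring)⟩

theorem mul (hf : HasWirtingerDerivAt f fz fzb x y) (hg : HasWirtingerDerivAt g gz gzb x y) :
    HasWirtingerDerivAt (fun x' y' => f x' y' * g x' y') (fz * g x y + f x y * gz)
      (fzb * g x y + f x y * gzb) x y :=
  ⟨(hf.left.mul hg.left).congr_deriv (by ring), (hf.right.mul hg.right).congr_deriv (by ring)⟩

theorem const_mul (c : ℂ) (hf : HasWirtingerDerivAt f fz fzb x y) :
    HasWirtingerDerivAt (fun x' y' => c * f x' y') (c * fz) (c * fzb) x y :=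
  ((const c x y).mul hf).congr_deriv (by ring) (by ring)

theorem star (hf : HasWirtingerDerivAt f fz fzb x y) :
    HasWirtingerDerivAt (fun x' y' => star (f x' y')) (star fzb) (star fz) x y :=
  ⟨hf.left.star.congr_deriv (by simp [add_comm]),
    hf.right.star.congr_deriv (by simp [← mul_neg])⟩

theorem comp {F : ℂ → ℂ} {F' : ℂ} (hF : HasDerivAt F F' (f x y))
    (hf : HasWirtingerDerivAt f fz fzb x y) :
    HasWirtingerDerivAt (fun x' y' => F (f x' y')) (F' * fz) (F' * fzb) x y :=
  ⟨(hF.scomp x hf.left).congr_deriv (by simp only [smul_eq_mul]; ring),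
    (hF.scomp y hf.right).congr_deriv (by simp only [smul_eq_mul]; ring)⟩

theorem re (hf : HasWirtingerDerivAt f fz fzb x y) :
    HasWirtingerDerivAt (fun x' y' => ((f x' y').re : ℂ)) ((fz + Star.star fzb) / 2)
      ((fzb + Star.star fz) / 2) x y := by
  simpa only [re_eq_add_conj, div_eq_inv_mul, star_def] using (hf.add hf.star).const_mul 2⁻¹

theorem im (hf : HasWirtingerDerivAt f fz fzb x y) :
    HasWirtingerDerivAt (fun x' y' => ((f x' y').im : ℂ)) ((fz - Star.star fzb) / (2 * I))
      ((fzb - Star.star fz) / (2 * I)) x y := by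
  simpa only [im_eq_sub_conj, div_eq_inv_mul, star_def, neg_one_mul, ← sub_eq_add_neg] using
    (hf.add (hf.star.const_mul (-1))).const_mul (2 * I)⁻¹

end HasWirtingerDerivAt

theorem dz_const_mul (c : ℂ) (f : ℝ → ℝ → ℂ) (x y : ℝ) :
    dz (fun x' y' => c * f x' y') x y = c * dz f x y := by
  simp only [dz, deriv_const_mul_field']
  ring

theorem dzbar_const_mul (c : ℂ) (f : ℝ → ℝ → ℂ) (x y : ℝ) :
    dzbar (fun x' y' => c * f x' y') x y = c * dzbar f x y := by
  simp only [dzbar, deriv_const_mul_field']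
  ring

theorem matDz_fin_two (f g h k : ℝ → ℝ → ℂ) (x y : ℝ) :
    matDz (fun x' y' => !![f x' y', g x' y'; h x' y', k x' y']) x y =
      !![dz f x y, dz g x y; dz h x y, dz k x y] := by
  ext i j
  fin_cases i <;> fin_cases j <;> rfl

theorem matDzbar_fin_two (f g h k : ℝ → ℝ → ℂ) (x y : ℝ) :
    matDzbar (fun x' y' => !![f x' y', g x' y'; h x' y', k x' y']) x y =
      !![dzbar f x y, dzbar g x y; dzbar h x y, dzbar k x y] := by
  ext i j
  fin_cases i <;> fin_cases j <;> rfl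

theorem matDt_fin_two (f g h k : ℝ → ℝ → ℝ → ℂ) (t x y : ℝ) :
    matDt (fun t' x' y' => !![f t' x' y', g t' x' y'; h t' x' y', k t' x' y']) t x y =
      !![deriv (fun t' => f t' x y) t, deriv (fun t' => g t' x y) t;
        deriv (fun t' => h t' x y) t, deriv (fun t' => k t' x y) t] := by
  ext i j
  fin_cases i <;> fin_cases j <;> rfl

section GradSize

variable {s : ℝ → ℝ → Fin 3 → ℝ} {wz wzb : ℂ} {x y : ℝ}

theorem HasWirtingerDerivAt.norm_add_norm_le_gradSize
    (hw : HasWirtingerDerivAt (fun x' y' => (s x' y' 0 : ℂ) + I * s x' y' 1) wz wzb x y) :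
    ‖wz‖ + ‖wzb‖ ≤ gradSize s x y := by
  have h0 := hw.re
  have h1 := hw.im
  simp only [add_re, add_im, mul_re, mul_im, I_re, I_im, ofReal_re, ofReal_im, zero_mul, one_mul,
    mul_zero, sub_zero, add_zero, zero_add] at h0 h1
  have hsum := h0.add (h1.const_mul I)
  have hz : ‖wz‖ ≤ ‖dz (fun x' y' => (s x' y' 0 : ℂ)) x y‖ +
      ‖dz (fun x' y' => (s x' y' 1 : ℂ)) x y‖ := by
    rw [← hw.dz_eq, hsum.dz_eq, h0.dz_eq, h1.dz_eq]
    exact (norm_add_le _ _).trans_eq (by rw [norm_mul I, norm_I, one_mul])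
  have hzbar : ‖wzb‖ ≤ ‖dzbar (fun x' y' => (s x' y' 0 : ℂ)) x y‖ +
      ‖dzbar (fun x' y' => (s x' y' 1 : ℂ)) x y‖ := by
    rw [← hw.dzbar_eq, hsum.dzbar_eq, h0.dzbar_eq, h1.dzbar_eq]
    exact (norm_add_le _ _).trans_eq (by rw [norm_mul I, norm_I, one_mul])
  rw [gradSize, Fin.sum_univ_three]
  linarith [norm_nonneg (dz (fun x' y' => (s x' y' 2 : ℂ)) x y),
    norm_nonneg (dzbar (fun x' y' => (s x' y' 2 : ℂ)) x y)]

theorem HasWirtingerDerivAt.gradSize_eq_zero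
    (hw : HasWirtingerDerivAt (fun x' y' => (s x' y' 0 : ℂ) + I * s x' y' 1) 0 0 x y)
    (hv : HasWirtingerDerivAt (fun x' y' => (s x' y' 2 : ℂ)) 0 0 x y) :
    gradSize s x y = 0 := by
  have h0 : HasWirtingerDerivAt (fun x' y' => (s x' y' 0 : ℂ)) 0 0 x y := by simpa using hw.re
  have h1 : HasWirtingerDerivAt (fun x' y' => (s x' y' 1 : ℂ)) 0 0 x y := by simpa using hw.im
  rw [gradSize, Fin.sum_univ_three, h0.dz_eq, h0.dzbar_eq, h1.dz_eq, h1.dzbar_eq, hv.dz_eq,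
    hv.dzbar_eq]
  simp

end GradSize

/-- The matrix with first row `(P, Q)` that has the shape of the elements of `SU(1,1)`; it belongs
to that group when `|P|² - |Q|² = 1`. -/
noncomputable def su11Matrix (P Q : ℂ) : Matrix (Fin 2) (Fin 2) ℂ := !![P, Q; star Q, star P]

/-- The vector `s` whose matrix is `-i G σ₃ G⁻¹` for `G = su11Matrix P Q` in `SU(1,1)`. -/
noncomputable def su11Spin (P Q : ℂ) : Fin 3 → ℝ :=
  ![(2 * I * P * Q).re, (2 * I * P * Q).im, -(‖P‖ ^ 2 + ‖Q‖ ^ 2)]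

section SU11

variable {P Q : ℂ}

theorem mul_star_sub_mul_star (h : ‖P‖ ^ 2 - ‖Q‖ ^ 2 = 1) : P * star P - Q * star Q = 1 := by
  rw [star_def, mul_conj', mul_conj']
  exact_mod_cast h

theorem det_su11Matrix (h : ‖P‖ ^ 2 - ‖Q‖ ^ 2 = 1) : (su11Matrix P Q).det = 1 := by
  rw [su11Matrix, Matrix.det_fin_two_of, mul_star_sub_mul_star h]

theorem su11Matrix_mem_SU11 (h : ‖P‖ ^ 2 - ‖Q‖ ^ 2 = 1) : su11Matrix P Q ∈ SU11 := by
  refine ⟨?_, det_su11Matrix h⟩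
  have h1 := mul_star_sub_mul_star h
  ext i j
  fin_cases i <;> fin_cases j <;>
    simp only [su11Matrix, sigma3, Fin.zero_eta, Fin.mk_one, Fin.isValue, Matrix.mul_apply,
      Matrix.conjTranspose_apply, Matrix.of_apply, Matrix.cons_val', Matrix.cons_val_zero,
      Matrix.cons_val_one, Matrix.cons_val_fin_one, Fin.sum_univ_two, star_star]
  · linear_combination h1
  · ring
  · ring
  · linear_combination -h1

theorem su11Spin_zero_add_I_mul_one (P Q : ℂ) :
    (su11Spin P Q 0 : ℂ) + I * su11Spin P Q 1 = 2 * I * P * Q := by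
  rw [mul_comm I]
  exact re_add_im _

theorem su11Spin_two (P Q : ℂ) : (su11Spin P Q 2 : ℂ) = -(P * star P + Q * star Q) := by
  simp [su11Spin, mul_conj']

theorem su11Spin_mem_hyperbolicPlane (h : ‖P‖ ^ 2 - ‖Q‖ ^ 2 = 1) :
    su11Spin P Q ∈ hyperbolicPlane := by
  have hw : su11Spin P Q 0 ^ 2 + su11Spin P Q 1 ^ 2 = (2 * ‖P‖ * ‖Q‖) ^ 2 := by
    have hn : ‖2 * I * P * Q‖ = 2 * ‖P‖ * ‖Q‖ := by simp
    rw [← hn, ← normSq_eq_norm_sq, normSq_apply, ← sq, ← sq]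
    rfl
  have hv : su11Spin P Q 2 = -(‖P‖ ^ 2 + ‖Q‖ ^ 2) := rfl
  constructor
  · rw [hw, hv]
    linear_combination (-(‖P‖ ^ 2 - ‖Q‖ ^ 2) - 1) * h
  · rw [hv]
    linarith [sq_nonneg ‖Q‖]

theorem spinMatrix_su11Spin (P Q : ℂ) :
    spinMatrix (su11Spin P Q) =
      !![-I * (P * star P + Q * star Q), 2 * I * P * Q;
        -1 * (2 * I * star P * star Q), I * (P * star P + Q * star Q)] := by
  have hw := su11Spin_zero_add_I_mul_one P Q
  have hwstar : (su11Spin P Q 0 : ℂ) - I * su11Spin P Q 1 = -1 * (2 * I * star P * star Q) := by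
    simpa [sub_eq_add_neg] using congrArg star hw
  rw [spinMatrix, hw, hwstar, su11Spin_two]
  simp only [mul_neg, neg_neg, neg_mul]

theorem spinMatrix_su11Spin_eq_conj (h : ‖P‖ ^ 2 - ‖Q‖ ^ 2 = 1) :
    spinMatrix (su11Spin P Q) = -(I • (su11Matrix P Q * sigma3 * (su11Matrix P Q)⁻¹)) := by
  rw [Matrix.inv_def, det_su11Matrix h, Ring.inverse_one, one_smul, spinMatrix_su11Spin,
    su11Matrix, Matrix.adjugate_fin_two_of, sigma3]
  simp only [Matrix.mul_fin_two, Matrix.smul_of, Matrix.neg_of]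
  ext i j
  fin_cases i <;> fin_cases j <;> simp <;> ring

end SU11

theorem matDz_matDzbar_spinMatrix_su11Spin (P Q : ℝ → ℝ → ℂ) (x y : ℝ) :
    matDz (matDzbar fun x' y' => spinMatrix (su11Spin (P x' y') (Q x' y'))) x y =
      !![-I * dz (dzbar fun x' y' => P x' y' * star (P x' y') + Q x' y' * star (Q x' y')) x y,
        dz (dzbar fun x' y' => 2 * I * P x' y' * Q x' y') x y;
        -1 * dz (dzbar fun x' y' => 2 * I * star (P x' y') * star (Q x' y')) x y,
        I * dz (dzbar fun x' y' => P x' y' * star (P x' y') + Q x' y' * star (Q x' y')) x y] := by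
  have hdzbar := funext₂ fun x y => matDzbar_fin_two
    (fun x' y' => -I * (P x' y' * star (P x' y') + Q x' y' * star (Q x' y')))
    (fun x' y' => 2 * I * P x' y' * Q x' y')
    (fun x' y' => -1 * (2 * I * star (P x' y') * star (Q x' y')))
    (fun x' y' => I * (P x' y' * star (P x' y') + Q x' y' * star (Q x' y'))) x y
  simp only [spinMatrix_su11Spin, hdzbar, matDz_fin_two, dzbar_const_mul, dz_const_mul]

section Smoothness

variable {E : Type*} [NormedAddCommGroup E] [NormedSpace ℝ E] {U : Set E} {n : WithTop ℕ∞}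
  {P Q : E → ℂ}

theorem contDiffOn_su11Matrix (hP : ContDiffOn ℝ n P U) (hQ : ContDiffOn ℝ n Q U) (j k : Fin 2) :
    ContDiffOn ℝ n (fun w => su11Matrix (P w) (Q w) j k) U := by
  fin_cases j <;> fin_cases k
  · exact hP
  · exact hQ
  · exact conjCLE.contDiff.comp_contDiffOn hQ
  · exact conjCLE.contDiff.comp_contDiffOn hP

theorem contDiffOn_su11Spin (hP : ContDiffOn ℝ n P U) (hQ : ContDiffOn ℝ n Q U) :
    ContDiffOn ℝ n (fun w => su11Spin (P w) (Q w)) U := by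
  have hw := (contDiffOn_const (c := 2 * I)).mul hP |>.mul hQ
  refine contDiffOn_pi.2 fun j => ?_
  fin_cases j
  · exact reCLM.contDiff.comp_contDiffOn hw
  · exact imCLM.contDiff.comp_contDiffOn hw
  · exact ((hP.norm_sq ℝ).add (hQ.norm_sq ℝ)).neg

end Smoothness

/-- The first row `(P, Q)` of an `SU(1,1)`-valued solution of the spatial part of the linear system
with coefficients `(0, q, r)`, at a fixed time. The equations for the second row `(Q̄, P̄)` are the
conjugates of these, and `compat` is the off-diagonal part of the zero curvature condition. -/
structure IsSpinorFrame (q r P Q : ℝ → ℝ → ℂ) : Prop where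
  norm_sq_sub : ∀ x y : ℝ, ‖P x y‖ ^ 2 - ‖Q x y‖ ^ 2 = 1
  wirtinger_P : ∀ x y : ℝ,
    HasWirtingerDerivAt P (-(r x y * Q x y)) (-(star (q x y) * Q x y)) x y
  wirtinger_Q : ∀ x y : ℝ,
    HasWirtingerDerivAt Q (-(q x y * P x y)) (-(star (r x y) * P x y)) x y
  wirtinger_q : ∀ x y : ℝ, HasWirtingerDerivAt q (dz q x y) (dzbar q x y) x y
  wirtinger_r : ∀ x y : ℝ, HasWirtingerDerivAt r (dz r x y) (dzbar r x y) x y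
  compat : ∀ x y : ℝ, dzbar r x y = star (dzbar q x y)

namespace IsSpinorFrame

variable {q r P Q : ℝ → ℝ → ℂ}

theorem star_swap (H : IsSpinorFrame q r P Q) :
    IsSpinorFrame r q (fun x y => star (P x y)) (fun x y => star (Q x y)) where
  norm_sq_sub x y := by simpa only [norm_star] using H.norm_sq_sub x y
  wirtinger_P x y := (H.wirtinger_P x y).star.congr_deriv (by simp) (by simp)
  wirtinger_Q x y := (H.wirtinger_Q x y).star.congr_deriv (by simp) (by simp)
  wirtinger_q := H.wirtinger_r
  wirtinger_r := H.wirtinger_q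
  compat x y := by rw [H.compat, star_star]

theorem wirtinger_mul (H : IsSpinorFrame q r P Q) (x y : ℝ) :
    HasWirtingerDerivAt (fun x' y' => 2 * I * P x' y' * Q x' y')
      (-2 * I * (q x y * P x y ^ 2 + r x y * Q x y ^ 2))
      (-2 * I * (star (r x y) * P x y ^ 2 + star (q x y) * Q x y ^ 2)) x y :=
  (((H.wirtinger_P x y).const_mul (2 * I)).mul (H.wirtinger_Q x y)).congr_deriv
    (by ring) (by ring)

theorem wirtinger_mul_star_add (H : IsSpinorFrame q r P Q) (x y : ℝ) :
    HasWirtingerDerivAt (fun x' y' => P x' y' * star (P x' y') + Q x' y' * star (Q x' y'))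
      (-2 * (q x y * P x y * star (Q x y) + r x y * star (P x y) * Q x y))
      (-2 * (star (r x y) * P x y * star (Q x y) + star (q x y) * star (P x y) * Q x y)) x y := by
  have hP := H.wirtinger_P x y
  have hQ := H.wirtinger_Q x y
  refine ((hP.mul hP.star).add (hQ.mul hQ.star)).congr_deriv ?_ ?_ <;>
    simp only [star_neg, star_mul', star_star] <;> ring

theorem dz_dzbar_mul (H : IsSpinorFrame q r P Q) (x y : ℝ) :
    dz (dzbar fun x' y' => 2 * I * P x' y' * Q x' y') x y =
      -2 * I * (dzbar q x y * P x y ^ 2 + star (dzbar q x y) * Q x y ^ 2) +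
        4 * I * (q x y * star (q x y) + r x y * star (r x y)) * P x y * Q x y := by
  have hP := H.wirtinger_P x y
  have hQ := H.wirtinger_Q x y
  have hq := (H.wirtinger_q x y).star
  have hr := (H.wirtinger_r x y).star
  have hdzbar : dzbar (fun x' y' => 2 * I * P x' y' * Q x' y') = fun x' y' => -2 * I *
      (star (r x' y') * (P x' y' * P x' y') + star (q x' y') * (Q x' y' * Q x' y')) :=
    funext₂ fun x' y' => by rw [(H.wirtinger_mul x' y').dzbar_eq, sq, sq]
  rw [hdzbar, (((hr.mul (hP.mul hP)).add (hq.mul (hQ.mul hQ))).const_mul (-2 * I)).dz_eq,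
    H.compat, star_star]
  ring

theorem dz_dzbar_mul_star_add (H : IsSpinorFrame q r P Q) (x y : ℝ) :
    dz (dzbar fun x' y' => P x' y' * star (P x' y') + Q x' y' * star (Q x' y')) x y =
      -2 * (dzbar q x y * P x y * star (Q x y) + star (dzbar q x y) * star (P x y) * Q x y) +
        2 * (q x y * star (q x y) + r x y * star (r x y)) *
          (P x y * star (P x y) + Q x y * star (Q x y)) := by
  have hP := H.wirtinger_P x y
  have hQ := H.wirtinger_Q x y
  have hq := (H.wirtinger_q x y).star
  have hr := (H.wirtinger_r x y).star
  have hdzbar : dzbar (fun x' y' => P x' y' * star (P x' y') + Q x' y' * star (Q x' y')) =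
      fun x' y' => -2 * (star (r x' y') * P x' y' * star (Q x' y') +
        star (q x' y') * star (P x' y') * Q x' y') :=
    funext₂ fun x' y' => (H.wirtinger_mul_star_add x' y').dzbar_eq
  rw [hdzbar, ((((hr.mul hP).mul hQ.star).add ((hq.mul hP.star).mul hQ)).const_mul (-2)).dz_eq,
    H.compat]
  simp only [star_neg, star_mul', star_star]
  ring

theorem norm_add_norm_le_gradSize (H : IsSpinorFrame q r P Q) (x y : ℝ) :
    ‖q x y‖ + ‖r x y‖ ≤ gradSize (fun x' y' => su11Spin (P x' y') (Q x' y')) x y := by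
  have hw := H.wirtinger_mul x y
  simp only [← su11Spin_zero_add_I_mul_one] at hw
  refine le_trans ?_ hw.norm_add_norm_le_gradSize
  have lower : ∀ c d : ℂ, 2 * (‖c‖ * ‖P x y‖ ^ 2 - ‖d‖ * ‖Q x y‖ ^ 2) ≤
      ‖-2 * I * (c * P x y ^ 2 + d * Q x y ^ 2)‖ := fun c d => by
    have h := norm_sub_le_norm_add (c * P x y ^ 2) (d * Q x y ^ 2)
    simp only [norm_mul, norm_pow, norm_neg, norm_I, norm_ofNat, mul_one] at h ⊢
    linarith
  have h1 := lower (q x y) (r x y)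
  have h2 := lower (star (r x y)) (star (q x y))
  rw [norm_star, norm_star] at h2
  calc ‖q x y‖ + ‖r x y‖ ≤ 2 * (‖q x y‖ + ‖r x y‖) * (‖P x y‖ ^ 2 - ‖Q x y‖ ^ 2) := by
        rw [H.norm_sq_sub]
        linarith [norm_nonneg (q x y), norm_nonneg (r x y)]
    _ ≤ _ := by linarith

theorem gradSize_eq_zero (H : IsSpinorFrame q r P Q) {x y : ℝ} (hq : q x y = 0) (hr : r x y = 0) :
    gradSize (fun x' y' => su11Spin (P x' y') (Q x' y')) x y = 0 := by
  have hw := H.wirtinger_mul x y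
  have hv := (H.wirtinger_mul_star_add x y).const_mul (-1)
  rw [hq, hr, star_zero] at hw hv
  refine HasWirtingerDerivAt.gradSize_eq_zero ?_ ?_
  · simpa only [su11Spin_zero_add_I_mul_one, zero_mul, add_zero, mul_zero] using hw
  · simpa only [su11Spin_two, zero_mul, add_zero, mul_zero, neg_one_mul] using hv

end IsSpinorFrame

/-- The first row `(P, Q)` of an `SU(1,1)`-valued solution of the full linear system with
coefficients `(0, q, r, u)` on `J × ℝ²`. -/
structure IsSpinorEvolution (J : Set ℝ) (q r : ℝ → ℝ → ℝ → ℂ) (u : ℝ → ℝ → ℝ → ℝ)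
    (P Q : ℝ → ℝ → ℝ → ℂ) : Prop where
  smooth_P : ContDiffOn ℝ ∞ (fun w : ℝ × ℝ × ℝ => P w.1 w.2.1 w.2.2) (J ×ˢ univ)
  smooth_Q : ContDiffOn ℝ ∞ (fun w : ℝ × ℝ × ℝ => Q w.1 w.2.1 w.2.2) (J ×ˢ univ)
  frame : ∀ t ∈ J, IsSpinorFrame (q t) (r t) (P t) (Q t)
  deriv_P : ∀ t ∈ J, ∀ x y : ℝ, HasDerivAt (fun t' => P t' x y)
    (I * (u t x y * P t x y + dzbar (r t) x y * Q t x y)) t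
  deriv_Q : ∀ t ∈ J, ∀ x y : ℝ, HasDerivAt (fun t' => Q t' x y)
    (-I * (dzbar (q t) x y * P t x y + u t x y * Q t x y)) t

namespace IsSpinorEvolution

variable {J : Set ℝ} {q r : ℝ → ℝ → ℝ → ℂ} {u : ℝ → ℝ → ℝ → ℝ} {P Q : ℝ → ℝ → ℝ → ℂ}

theorem isGaugeTransform (H : IsSpinorEvolution J q r u P Q) :
    IsGaugeTransform J (fun _ _ _ => 0) q r u (fun t x y => su11Matrix (P t x y) (Q t x y))
      (fun t x y => su11Spin (P t x y) (Q t x y)) where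
  smooth := contDiffOn_su11Matrix H.smooth_P H.smooth_Q
  mem t ht x y := su11Matrix_mem_SU11 ((H.frame t ht).norm_sq_sub x y)
  eqn_z t ht x y := by
    have hP := (H.frame t ht).wirtinger_P x y
    have hQ := (H.frame t ht).wirtinger_Q x y
    simp only [su11Matrix, matDz_fin_two, hP.dz_eq, hQ.dz_eq, hP.star.dz_eq, hQ.star.dz_eq]
    ext i j
    fin_cases i <;> fin_cases j <;> simp <;> ring
  eqn_zbar t ht x y := by
    have hP := (H.frame t ht).wirtinger_P x y
    have hQ := (H.frame t ht).wirtinger_Q x y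
    simp only [su11Matrix, matDzbar_fin_two, hP.dzbar_eq, hQ.dzbar_eq, hP.star.dzbar_eq,
      hQ.star.dzbar_eq]
    ext i j
    fin_cases i <;> fin_cases j <;> simp <;> ring
  eqn_t t ht x y := by
    have hP := H.deriv_P t ht x y
    have hQ := H.deriv_Q t ht x y
    simp only [su11Matrix, matDt_fin_two, hP.deriv, hQ.deriv, hP.star.deriv, hQ.star.deriv,
      (H.frame t ht).compat]
    ext i j
    fin_cases i <;> fin_cases j <;> simp <;> ring
  spin_eq t ht x y := spinMatrix_su11Spin_eq_conj ((H.frame t ht).norm_sq_sub x y)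

theorem hasDerivAt_mul (H : IsSpinorEvolution J q r u P Q) {t : ℝ} (ht : t ∈ J) (x y : ℝ) :
    HasDerivAt (fun t' => 2 * I * P t' x y * Q t' x y)
      (2 * (dzbar (q t) x y * P t x y ^ 2 - star (dzbar (q t) x y) * Q t x y ^ 2)) t := by
  have hP := H.deriv_P t ht x y
  have hQ := H.deriv_Q t ht x y
  rw [(H.frame t ht).compat] at hP
  refine ((hP.const_mul (2 * I)).fun_mul hQ).congr_deriv ?_
  linear_combination 2 * (star (dzbar (q t) x y) * Q t x y ^ 2 - dzbar (q t) x y * P t x y ^ 2) *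
    I_sq

theorem hasDerivAt_mul_star_add (H : IsSpinorEvolution J q r u P Q) {t : ℝ} (ht : t ∈ J)
    (x y : ℝ) :
    HasDerivAt (fun t' => P t' x y * star (P t' x y) + Q t' x y * star (Q t' x y))
      (2 * I * (star (dzbar (q t) x y) * star (P t x y) * Q t x y -
        dzbar (q t) x y * P t x y * star (Q t x y))) t := by
  have hP := H.deriv_P t ht x y
  have hQ := H.deriv_Q t ht x y
  rw [(H.frame t ht).compat] at hP
  refine ((hP.fun_mul hP.star).fun_add (hQ.fun_mul hQ.star)).congr_deriv ?_
  simp only [star_mul', star_add, star_neg, star_def, conj_I, conj_ofReal, conj_conj]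
  ring

theorem matDt_spinMatrix (H : IsSpinorEvolution J q r u P Q) {t : ℝ} (ht : t ∈ J) (x y : ℝ) :
    matDt (fun t' x' y' => spinMatrix (su11Spin (P t' x' y') (Q t' x' y'))) t x y =
      !![-I * (2 * I * (star (dzbar (q t) x y) * star (P t x y) * Q t x y -
            dzbar (q t) x y * P t x y * star (Q t x y))),
          2 * (dzbar (q t) x y * P t x y ^ 2 - star (dzbar (q t) x y) * Q t x y ^ 2);
        2 * (star (dzbar (q t) x y) * star (P t x y) ^ 2 -
            dzbar (q t) x y * star (Q t x y) ^ 2),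
          I * (2 * I * (star (dzbar (q t) x y) * star (P t x y) * Q t x y -
            dzbar (q t) x y * P t x y * star (Q t x y)))] := by
  have hw := H.hasDerivAt_mul ht x y
  have hwstar : HasDerivAt (fun t' => -1 * (2 * I * star (P t' x y) * star (Q t' x y)))
      (2 * (star (dzbar (q t) x y) * star (P t x y) ^ 2 -
        dzbar (q t) x y * star (Q t x y) ^ 2)) t := by
    simpa using hw.star
  have hv := H.hasDerivAt_mul_star_add ht x y
  simp only [spinMatrix_su11Spin, matDt_fin_two]
  rw [hw.deriv, hwstar.deriv, (hv.const_mul (-I)).deriv, (hv.const_mul I).deriv]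

theorem isSmoothSchrodingerMap (H : IsSpinorEvolution J q r u P Q) :
    IsSmoothSchrodingerMap J (fun t x y => su11Spin (P t x y) (Q t x y)) where
  smooth := contDiffOn_su11Spin H.smooth_P H.smooth_Q
  mem t ht x y := su11Spin_mem_hyperbolicPlane ((H.frame t ht).norm_sq_sub x y)
  eqn t ht x y := by
    have h := mul_star_sub_mul_star ((H.frame t ht).norm_sq_sub x y)
    have hstar := (H.frame t ht).star_swap.dz_dzbar_mul x y
    rw [(H.frame t ht).compat, star_star] at hstar
    rw [H.matDt_spinMatrix ht, matDz_matDzbar_spinMatrix_su11Spin, spinMatrix_su11Spin,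
      (H.frame t ht).dz_dzbar_mul, (H.frame t ht).dz_dzbar_mul_star_add, hstar]
    generalize P t x y = p, Q t x y = q, dzbar (q t) x y = k at h ⊢
    rw [Matrix.mul_fin_two, Matrix.mul_fin_two]
    ext i j
    fin_cases i <;> fin_cases j <;>
      simp only [Fin.zero_eta, Fin.mk_one, Matrix.smul_apply, Matrix.sub_apply, Matrix.of_apply,
        Matrix.cons_val_zero, Matrix.cons_val_one, smul_eq_mul]
    · linear_combination 2 * I ^ 2 * (star k * star p * q - k * p * star q) * h
    · linear_combination 2 * (k * p ^ 2 - star k * q ^ 2) * (I_sq + I ^ 2 * h)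
    · linear_combination 2 * (star k * star p ^ 2 - k * star q ^ 2) * (I_sq + I ^ 2 * h)
    · linear_combination -2 * I ^ 2 * (star k * star p * q - k * p * star q) * h

end IsSpinorEvolution

/-- First entry of the explicit spinor, as a function of the amplitude `m = (a + bt)^{1/4}` and the
half phase `κ = b z z̄ / (4 (a + bt))`. At fixed `m` it is a linear function of `κ` times an
exponential. -/
noncomputable def spinorP (m κ : ℂ) : ℂ := ((m + m⁻¹) / 2 + I * m * κ) * exp (-(I * κ))

/-- Second entry of the explicit spinor; `ε = ±1` is the sign of `α / b`. -/
noncomputable def spinorQ (ε m κ : ℂ) : ℂ := -I * ε * ((m - m⁻¹) / 2 - I * m * κ) * exp (I * κ)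

section Spinor

variable {ε : ℂ}

theorem exp_mul_spinorQ (m κ : ℂ) :
    exp (-(2 * I) * κ) * spinorQ ε m κ = -I * ε * ((m - m⁻¹) / 2 - I * m * κ) * exp (-(I * κ)) := by
  have h : exp (-(2 * I) * κ) * exp (I * κ) = exp (-(I * κ)) := by rw [← exp_add]; ring_nf
  rw [spinorQ, ← h]
  ring

theorem exp_mul_spinorP (m κ : ℂ) :
    exp (2 * I * κ) * spinorP m κ = ((m + m⁻¹) / 2 + I * m * κ) * exp (I * κ) := by
  have h : exp (2 * I * κ) * exp (-(I * κ)) = exp (I * κ) := by rw [← exp_add]; ring_nf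
  rw [spinorP, ← h]
  ring

theorem norm_spinorP_sq_sub_norm_spinorQ_sq {m : ℝ} (hm : m ≠ 0) (κ : ℝ) (hε : ε ^ 2 = 1) :
    ‖spinorP m κ‖ ^ 2 - ‖spinorQ ε m κ‖ ^ 2 = 1 := by
  have hP : ‖spinorP m κ‖ ^ 2 = ((m + m⁻¹) / 2) ^ 2 + (m * κ) ^ 2 := by
    have h : ((m : ℂ) + (m : ℂ)⁻¹) / 2 + I * m * κ = ((m + m⁻¹) / 2 : ℝ) + (m * κ : ℝ) * I := by
      push_cast
      ring
    rw [spinorP, norm_mul, norm_exp, h, mul_pow, ← normSq_eq_norm_sq, normSq_add_mul_I]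
    simp
  have hQ : ‖spinorQ ε m κ‖ ^ 2 = ((m - m⁻¹) / 2) ^ 2 + (m * κ) ^ 2 := by
    have h : ((m : ℂ) - (m : ℂ)⁻¹) / 2 - I * m * κ = ((m - m⁻¹) / 2 : ℝ) + (-(m * κ) : ℝ) * I := by
      push_cast
      ring
    rw [spinorQ, norm_mul, norm_mul, norm_mul, norm_exp, h, mul_pow, mul_pow, mul_pow, ← norm_pow ε,
      hε, ← normSq_eq_norm_sq (_ + _), normSq_add_mul_I]
    simp
  rw [hP, hQ]
  field_simp
  ring

variable {𝕜 : Type*} [NontriviallyNormedField 𝕜] [NormedAlgebra 𝕜 ℂ] {m κ : 𝕜 → ℂ} {μ κ' : ℂ}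
  {t : 𝕜}

theorem hasDerivAt_spinorP (hε : ε ^ 2 = 1) (h0 : m t ≠ 0) (hm : HasDerivAt m (μ * m t) t)
    (hκ : HasDerivAt κ κ' t) :
    HasDerivAt (fun t' => spinorP (m t') (κ t'))
      (μ * (2 * I * κ t * spinorP (m t) (κ t) +
          I * ε * (1 + 2 * I * κ t) * (exp (-(2 * I) * κ t) * spinorQ ε (m t) (κ t))) -
        κ' * ε * (exp (-(2 * I) * κ t) * spinorQ ε (m t) (κ t))) t := by
  have h := (((hm.fun_add (hm.fun_inv h0)).div_const 2).fun_add
    ((hm.const_mul I).fun_mul hκ)).fun_mul (hκ.const_mul I).fun_neg.cexp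
  refine h.congr_deriv ?_
  have hinv : -(μ * m t) / m t ^ 2 = -μ * (m t)⁻¹ := by field_simp
  rw [exp_mul_spinorQ, spinorP, hinv]
  linear_combination
    exp (-(I * κ t)) * μ * ((m t - (m t)⁻¹) / 2 - I * κ t * (m t)⁻¹ - 2 * I ^ 2 * m t * κ t ^ 2) *
        I_sq +
      exp (-(I * κ t)) * ((m t - (m t)⁻¹) / 2 - I * m t * κ t) *
        (μ * I ^ 2 * (1 + 2 * I * κ t) - κ' * I) * hε

theorem hasDerivAt_spinorQ (h0 : m t ≠ 0) (hm : HasDerivAt m (μ * m t) t)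
    (hκ : HasDerivAt κ κ' t) :
    HasDerivAt (fun t' => spinorQ ε (m t') (κ t'))
      (-μ * (I * ε * (1 - 2 * I * κ t) * (exp (2 * I * κ t) * spinorP (m t) (κ t)) +
          2 * I * κ t * spinorQ ε (m t) (κ t)) -
        κ' * ε * (exp (2 * I * κ t) * spinorP (m t) (κ t))) t := by
  have h := (((hm.fun_sub (hm.fun_inv h0)).div_const 2).fun_sub
    ((hm.const_mul I).fun_mul hκ)).const_mul (-I * ε) |>.fun_mul (hκ.const_mul I).cexp
  refine h.congr_deriv ?_
  have hinv : -(μ * m t) / m t ^ 2 = -μ * (m t)⁻¹ := by field_simp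
  rw [exp_mul_spinorP, spinorQ, hinv]
  linear_combination
    κ' * ε * exp (I * κ t) * ((m t + (m t)⁻¹) / 2 + I * m t * κ t) * I_sq

theorem hasDerivAt_spinorP_right (hε : ε ^ 2 = 1) {m : ℂ} (h0 : m ≠ 0) (κ : ℂ) :
    HasDerivAt (spinorP m) (-(ε * (exp (-(2 * I) * κ) * spinorQ ε m κ))) κ := by
  have hm : HasDerivAt (fun _ : ℂ => m) (0 * m) κ := by simpa using hasDerivAt_const κ m
  exact (hasDerivAt_spinorP hε h0 hm (hasDerivAt_id' κ)).congr_deriv (by ring)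

theorem hasDerivAt_spinorQ_right {m : ℂ} (h0 : m ≠ 0) (κ : ℂ) :
    HasDerivAt (spinorQ ε m) (-(ε * (exp (2 * I * κ) * spinorP m κ))) κ := by
  have hm : HasDerivAt (fun _ : ℂ => m) (0 * m) κ := by simpa using hasDerivAt_const κ m
  exact (hasDerivAt_spinorQ h0 hm (hasDerivAt_id' κ)).congr_deriv (by ring)

variable {E : Type*} [NormedAddCommGroup E] [NormedSpace ℝ E] {U : Set E} {n : WithTop ℕ∞}
  {M K : E → ℂ}

theorem contDiffOn_spinorP (hM : ContDiffOn ℝ n M U) (h0 : ∀ w ∈ U, M w ≠ 0)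
    (hK : ContDiffOn ℝ n K U) : ContDiffOn ℝ n (fun w => spinorP (M w) (K w)) U :=
  (((hM.add (hM.inv h0)).div_const 2).add ((contDiffOn_const.mul hM).mul hK)).mul
    (contDiffOn_const.mul hK).neg.cexp

theorem contDiffOn_spinorQ (hM : ContDiffOn ℝ n M U) (h0 : ∀ w ∈ U, M w ≠ 0)
    (hK : ContDiffOn ℝ n K U) : ContDiffOn ℝ n (fun w => spinorQ ε (M w) (K w)) U :=
  (contDiffOn_const.mul (((hM.sub (hM.inv h0)).div_const 2).sub
    ((contDiffOn_const.mul hM).mul hK))).mul (contDiffOn_const.mul hK).cexp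

end Spinor

/-- The amplitude `(a + bt)^{1/4}` of the explicit solution. -/
noncomputable def fourthRoot (a b t : ℝ) : ℝ := (a + b * t) ^ (1 / 4 : ℝ)

/-- Half of the phase of `qExplicit`, that is `b z z̄ / (4 (a + bt))`. -/
noncomputable def halfPhase (a b t x y : ℝ) : ℝ := b * ‖zc x y‖ ^ 2 / (4 * (a + b * t))

section Explicit

theorem zc_eq_zero_iff {x y : ℝ} : zc x y = 0 ↔ (x, y) = (0, 0) := by
  simp [zc, Complex.ext_iff]

theorem hasWirtingerDerivAt_zc (x y : ℝ) : HasWirtingerDerivAt zc 1 0 x y :=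
  ⟨((ofRealCLM.hasDerivAt.add_const _).div_const 2).congr_deriv (by simp),
    (((ofRealCLM.hasDerivAt.const_mul I).const_add (x : ℂ)).div_const 2).congr_deriv (by simp)⟩

theorem hasWirtingerDerivAt_zc_mul_star (x y : ℝ) :
    HasWirtingerDerivAt (fun x' y' => zc x' y' * star (zc x' y')) (star (zc x y)) (zc x y) x y :=
  have h := hasWirtingerDerivAt_zc x y
  (h.mul h.star).congr_deriv (by simp) (by simp)

variable {a b t : ℝ}

theorem ofReal_halfPhase (a b t x y : ℝ) :
    (halfPhase a b t x y : ℂ) = b / (4 * (a + b * t)) * (zc x y * star (zc x y)) := by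
  rw [halfPhase, star_def, mul_conj']
  push_cast
  ring

theorem hasWirtingerDerivAt_halfPhase (a b t x y : ℝ) :
    HasWirtingerDerivAt (fun x' y' => (halfPhase a b t x' y' : ℂ))
      (b / (4 * (a + b * t)) * star (zc x y)) (b / (4 * (a + b * t)) * zc x y) x y := by
  simpa only [ofReal_halfPhase] using (hasWirtingerDerivAt_zc_mul_star x y).const_mul _

theorem hasDerivAt_add_mul (a b t : ℝ) : HasDerivAt (fun t' => a + b * t') b t := by
  simpa using ((hasDerivAt_id t).const_mul b).const_add a

theorem hasDerivAt_halfPhase (ht : a + b * t ≠ 0) (x y : ℝ) :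
    HasDerivAt (fun t' => halfPhase a b t' x y) (-(b / (a + b * t) * halfPhase a b t x y)) t := by
  have h := (hasDerivAt_add_mul a b t).const_mul 4
  refine ((hasDerivAt_const t (b * ‖zc x y‖ ^ 2)).fun_div h (by positivity)).congr_deriv ?_
  rw [halfPhase]
  field_simp
  ring

theorem hasDerivAt_fourthRoot (ht : a + b * t ≠ 0) :
    HasDerivAt (fourthRoot a b) (b / (4 * (a + b * t)) * fourthRoot a b t) t := by
  refine ((hasDerivAt_add_mul a b t).rpow_const (.inl ht)).congr_deriv ?_
  rw [fourthRoot, Real.rpow_sub_one ht]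
  field_simp

theorem contDiffOn_ofReal_fourthRoot (a b : ℝ) :
    ContDiffOn ℝ ∞ (fun w : ℝ × ℝ × ℝ => (fourthRoot a b w.1 : ℂ))
      ({t | 0 < a + b * t} ×ˢ univ) :=
  ofRealCLM.contDiff.comp_contDiffOn
    (ContDiffOn.rpow_const_of_ne (by fun_prop) fun _ hw => hw.1.ne')

theorem contDiffOn_ofReal_halfPhase (a b : ℝ) :
    ContDiffOn ℝ ∞ (fun w : ℝ × ℝ × ℝ => (halfPhase a b w.1 w.2.1 w.2.2 : ℂ))
      ({t | 0 < a + b * t} ×ˢ univ) := by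
  have hz : ContDiff ℝ ∞ fun w : ℝ × ℝ × ℝ => zc w.2.1 w.2.2 :=
    ((ofRealCLM.contDiff.comp (by fun_prop)).add
      (contDiff_const.mul (ofRealCLM.contDiff.comp (by fun_prop)))).div_const 2
  refine ofRealCLM.contDiff.comp_contDiffOn
    (ContDiffOn.div ?_ (by fun_prop) fun w hw => mul_ne_zero four_ne_zero hw.1.ne')
  exact (contDiff_const.mul (hz.norm_sq ℝ)).contDiffOn

theorem qExplicit_eq (a b α t x y : ℝ) :
    qExplicit a b α t x y =
      α / (a + b * t) * (exp (2 * I * halfPhase a b t x y) * star (zc x y)) := by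
  rw [qExplicit, ofReal_halfPhase]
  generalize (a + b * t : ℂ) = τ
  ring_nf

theorem rExplicit_eq (a b α t x y : ℝ) :
    rExplicit a b α t x y =
      α / (a + b * t) * (exp (-(2 * I) * halfPhase a b t x y) * star (zc x y)) := by
  rw [rExplicit, ofReal_halfPhase]
  generalize (a + b * t : ℂ) = τ
  ring_nf

theorem uExplicit_eq {ε : ℝ} (hε : ε ^ 2 = 1) (a b t x y : ℝ) :
    uExplicit a b (ε * b / 4) t x y = b / (2 * (a + b * t)) * halfPhase a b t x y := by
  rw [uExplicit, halfPhase]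
  generalize a + b * t = τ
  linear_combination b ^ 2 * ‖zc x y‖ ^ 2 / (8 * τ ^ 2) * hε

theorem norm_qExplicit (a b α t x y : ℝ) :
    ‖qExplicit a b α t x y‖ = |α| / |a + b * t| * ‖zc x y‖ := by
  have hτ : (α / (a + b * t) : ℂ) = (α / (a + b * t) : ℝ) := by push_cast; rfl
  rw [qExplicit_eq, norm_mul, norm_mul, norm_exp, hτ, norm_real, Real.norm_eq_abs, abs_div,
    norm_star]
  simp

theorem hasWirtingerDerivAt_exp_halfPhase (a b t : ℝ) (c d : ℂ) (x y : ℝ) :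
    HasWirtingerDerivAt
      (fun x' y' => d * (exp (c * halfPhase a b t x' y') * star (zc x' y')))
      (d * (exp (c * halfPhase a b t x y) * (c * (b / (4 * (a + b * t)) * star (zc x y) ^ 2))))
      (d * (exp (c * halfPhase a b t x y) * (1 + c * halfPhase a b t x y))) x y := by
  have hexp := ((hasWirtingerDerivAt_halfPhase a b t x y).const_mul c).comp (hasDerivAt_exp _)
  refine ((hexp.mul (hasWirtingerDerivAt_zc x y).star).const_mul d).congr_deriv ?_ ?_
  · rw [star_zero]
    ring
  · rw [star_one, ofReal_halfPhase]
    ring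

theorem hasWirtingerDerivAt_qExplicit (a b α t x y : ℝ) :
    HasWirtingerDerivAt (qExplicit a b α t)
      (α / (a + b * t) * (exp (2 * I * halfPhase a b t x y) *
        (2 * I * (b / (4 * (a + b * t)) * star (zc x y) ^ 2))))
      (α / (a + b * t) * (exp (2 * I * halfPhase a b t x y) * (1 + 2 * I * halfPhase a b t x y)))
      x y := by
  rw [funext₂ (qExplicit_eq a b α t)]
  exact hasWirtingerDerivAt_exp_halfPhase a b t (2 * I) _ x y

theorem hasWirtingerDerivAt_rExplicit (a b α t x y : ℝ) :
    HasWirtingerDerivAt (rExplicit a b α t)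
      (α / (a + b * t) * (exp (-(2 * I) * halfPhase a b t x y) *
        (-(2 * I) * (b / (4 * (a + b * t)) * star (zc x y) ^ 2))))
      (α / (a + b * t) *
        (exp (-(2 * I) * halfPhase a b t x y) * (1 + -(2 * I) * halfPhase a b t x y))) x y := by
  rw [funext₂ (rExplicit_eq a b α t)]
  exact hasWirtingerDerivAt_exp_halfPhase a b t (-(2 * I)) _ x y

theorem dzbar_rExplicit (a b α t x y : ℝ) :
    dzbar (rExplicit a b α t) x y = star (dzbar (qExplicit a b α t) x y) := by
  rw [(hasWirtingerDerivAt_qExplicit a b α t x y).dzbar_eq,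
    (hasWirtingerDerivAt_rExplicit a b α t x y).dzbar_eq]
  simp only [star_def, map_mul, map_add, map_div₀, map_one, map_ofNat, conj_I, conj_ofReal,
    ← exp_conj, mul_neg]

theorem fourthRoot_pos (ht : 0 < a + b * t) : 0 < fourthRoot a b t :=
  Real.rpow_pos_of_pos ht _

theorem star_qExplicit (a b α t x y : ℝ) :
    star (qExplicit a b α t x y) =
      α / (a + b * t) * (exp (-(2 * I) * halfPhase a b t x y) * zc x y) := by
  rw [qExplicit_eq]
  simp only [star_def, map_mul, map_add, map_div₀, map_ofNat, conj_I, conj_ofReal, ← exp_conj,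
    conj_conj, mul_neg]

theorem star_rExplicit (a b α t x y : ℝ) :
    star (rExplicit a b α t x y) =
      α / (a + b * t) * (exp (2 * I * halfPhase a b t x y) * zc x y) := by
  rw [rExplicit_eq]
  simp only [star_def, map_mul, map_add, map_neg, map_div₀, map_ofNat, conj_I, conj_ofReal,
    ← exp_conj, conj_conj, mul_neg, neg_neg]

theorem isSpinorFrame_explicit {ε : ℝ} (hε : ε ^ 2 = 1) (ht : 0 < a + b * t) :
    IsSpinorFrame (qExplicit a b (ε * b / 4) t) (rExplicit a b (ε * b / 4) t)
      (fun x y => spinorP (fourthRoot a b t) (halfPhase a b t x y))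
      (fun x y => spinorQ ε (fourthRoot a b t) (halfPhase a b t x y)) where
  norm_sq_sub x y :=
    norm_spinorP_sq_sub_norm_spinorQ_sq (fourthRoot_pos ht).ne' _ (by exact_mod_cast hε)
  wirtinger_P x y := by
    have hP := hasDerivAt_spinorP_right (ε := ε) (by exact_mod_cast hε)
      (ofReal_ne_zero.2 (fourthRoot_pos ht).ne') (halfPhase a b t x y)
    refine (HasWirtingerDerivAt.comp (f := fun x' y' => (halfPhase a b t x' y' : ℂ)) hP
      (hasWirtingerDerivAt_halfPhase a b t x y)).congr_deriv ?_ ?_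
    · rw [rExplicit_eq]
      generalize (a + b * t : ℂ) = τ
      push_cast
      ring
    · rw [star_qExplicit]
      generalize (a + b * t : ℂ) = τ
      push_cast
      ring
  wirtinger_Q x y := by
    have hQ := hasDerivAt_spinorQ_right (ε := ε)
      (ofReal_ne_zero.2 (fourthRoot_pos ht).ne') (halfPhase a b t x y)
    refine (HasWirtingerDerivAt.comp (f := fun x' y' => (halfPhase a b t x' y' : ℂ)) hQ
      (hasWirtingerDerivAt_halfPhase a b t x y)).congr_deriv ?_ ?_
    · rw [qExplicit_eq]
      generalize (a + b * t : ℂ) = τ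
      push_cast
      ring
    · rw [star_rExplicit]
      generalize (a + b * t : ℂ) = τ
      push_cast
      ring
  wirtinger_q x y := (hasWirtingerDerivAt_qExplicit a b _ t x y).hasWirtingerDerivAt_dz_dzbar
  wirtinger_r x y := (hasWirtingerDerivAt_rExplicit a b _ t x y).hasWirtingerDerivAt_dz_dzbar
  compat := dzbar_rExplicit a b _ t

theorem isSpinorEvolution_explicit {ε : ℝ} (hε : ε ^ 2 = 1) (a b : ℝ) :
    IsSpinorEvolution {t | 0 < a + b * t} (qExplicit a b (ε * b / 4)) (rExplicit a b (ε * b / 4))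
      (uExplicit a b (ε * b / 4))
      (fun t x y => spinorP (fourthRoot a b t) (halfPhase a b t x y))
      (fun t x y => spinorQ ε (fourthRoot a b t) (halfPhase a b t x y)) where
  smooth_P := contDiffOn_spinorP (contDiffOn_ofReal_fourthRoot a b)
    (fun w hw => ofReal_ne_zero.2 (fourthRoot_pos hw.1).ne') (contDiffOn_ofReal_halfPhase a b)
  smooth_Q := contDiffOn_spinorQ (contDiffOn_ofReal_fourthRoot a b)
    (fun w hw => ofReal_ne_zero.2 (fourthRoot_pos hw.1).ne') (contDiffOn_ofReal_halfPhase a b)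
  frame t ht := isSpinorFrame_explicit hε ht
  deriv_P t ht x y := by
    have hm := (hasDerivAt_fourthRoot ht.ne').ofReal_comp
    have hκ := (hasDerivAt_halfPhase ht.ne' x y).ofReal_comp
    rw [ofReal_mul] at hm
    have hP := hasDerivAt_spinorP (m := fun t' => (fourthRoot a b t' : ℂ)) (ε := ε)
      (by exact_mod_cast hε) (ofReal_ne_zero.2 (fourthRoot_pos ht).ne') hm hκ
    refine hP.congr_deriv ?_
    rw [uExplicit_eq hε, (hasWirtingerDerivAt_rExplicit a b _ t x y).dzbar_eq]
    push_cast
    generalize (a + b * t : ℂ) = τ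
    linear_combination b / τ * halfPhase a b t x y * ε *
      (exp (-(2 * I) * halfPhase a b t x y) *
        spinorQ ε (fourthRoot a b t) (halfPhase a b t x y)) * I_sq
  deriv_Q t ht x y := by
    have hm := (hasDerivAt_fourthRoot ht.ne').ofReal_comp
    have hκ := (hasDerivAt_halfPhase ht.ne' x y).ofReal_comp
    rw [ofReal_mul] at hm
    have hQ := hasDerivAt_spinorQ (m := fun t' => (fourthRoot a b t' : ℂ)) (ε := ε)
      (ofReal_ne_zero.2 (fourthRoot_pos ht).ne') hm hκ
    refine hQ.congr_deriv ?_
    rw [uExplicit_eq hε, (hasWirtingerDerivAt_qExplicit a b _ t x y).dzbar_eq]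
    push_cast
    generalize (a + b * t : ℂ) = τ
    linear_combination b / τ * halfPhase a b t x y * ε *
      (exp (2 * I * halfPhase a b t x y) *
        spinorP (fourthRoot a b t) (halfPhase a b t x y)) * I_sq

theorem setOf_add_mul_pos_of_neg (a : ℝ) (hb : b < 0) : {t | 0 < a + b * t} = Iio (-a / b) := by
  ext t
  rw [mem_ofPred_eq, mem_Iio, lt_div_iff_of_neg hb]
  constructor <;> intro h <;> linarith

theorem tendsto_add_mul_nhdsWithin (a : ℝ) (hb : b ≠ 0) :
    Tendsto (fun t => a + b * t) (𝓝[{t | 0 < a + b * t}] (-a / b)) (𝓝[>] 0) := by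
  refine tendsto_nhdsWithin_iff.2 ⟨?_, eventually_mem_nhdsWithin⟩
  have h := (hasDerivAt_add_mul a b (-a / b)).continuousAt.tendsto
  rw [mul_div_cancel₀ _ hb, add_neg_cancel] at h
  exact h.mono_left nhdsWithin_le_nhds

theorem neBot_nhdsWithin_add_mul_pos (a : ℝ) (hb : b ≠ 0) :
    (𝓝[{t | 0 < a + b * t}] (-a / b)).NeBot := by
  have h := ((Homeomorph.mulLeft₀ b hb).trans (Homeomorph.addLeft a)).preimage_closure (Ioi 0)
  rw [closure_Ioi] at h
  refine mem_closure_iff_nhdsWithin_neBot.1 (h.subset ?_)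
  simp [mul_div_cancel₀ _ hb]

theorem tendsto_norm_qExplicit_atTop {α : ℝ} (hb : b ≠ 0) (hα : α ≠ 0) {x y : ℝ}
    (hz : zc x y ≠ 0) :
    Tendsto (fun t => ‖qExplicit a b α t x y‖) (𝓝[{t | 0 < a + b * t}] (-a / b)) atTop := by
  have hinv := (tendsto_add_mul_nhdsWithin a hb).inv_tendsto_nhdsGT_zero
  refine (hinv.const_mul_atTop (mul_pos (abs_pos.2 hα) (norm_pos_iff.2 hz))).congr' ?_
  filter_upwards [self_mem_nhdsWithin] with t ht
  rw [norm_qExplicit, abs_of_pos ht, Pi.inv_apply]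
  ring

end Explicit

theorem theorem4_general (a b α : ℝ) (hb : b ≠ 0) (hα : α ^ 2 = b ^ 2 / 16) :
    ∃ (s : ℝ → ℝ → ℝ → Fin 3 → ℝ) (G : ℝ → ℝ → ℝ → Matrix (Fin 2) (Fin 2) ℂ),
      IsSmoothSchrodingerMap {t | 0 < a + b * t} s ∧
      (∀ x y : ℝ, Tendsto (fun t => gradSize (s t) x y) (𝓝[{t | 0 < a + b * t}] (-a / b)) atTop ↔
        (x, y) ≠ (0, 0)) ∧
      IsGaugeTransform {t | 0 < a + b * t} (fun _ _ _ => 0) (qExplicit a b α) (rExplicit a b α)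
        (uExplicit a b α) G s ∧
      ∀ t ∈ {t | 0 < a + b * t}, ∀ x y : ℝ,
        ‖qExplicit a b α t x y‖ + ‖rExplicit a b α t x y‖ ≤ gradSize (s t) x y := by
  have hα0 : α ≠ 0 := by
    rintro rfl
    exact hb (pow_eq_zero_iff two_ne_zero |>.1 (by linarith))
  obtain ⟨ε, hε, rfl⟩ : ∃ ε : ℝ, ε ^ 2 = 1 ∧ α = ε * b / 4 :=
    ⟨4 * α / b, by field_simp; linear_combination 16 * hα, by field_simp⟩
  have H := isSpinorEvolution_explicit hε a b
  refine ⟨_, _, H.isSmoothSchrodingerMap, fun x y => ⟨?_, fun hxy => ?_⟩, H.isGaugeTransform,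
    fun t ht => (H.frame t ht).norm_add_norm_le_gradSize⟩
  · rintro hlim hxy
    obtain ⟨rfl, rfl⟩ := Prod.mk.inj hxy
    have := neBot_nhdsWithin_add_mul_pos a hb
    have hz : zc 0 0 = 0 := zc_eq_zero_iff.2 rfl
    refine not_tendsto_const_atTop (0 : ℝ) _ (hlim.congr' ?_)
    filter_upwards [self_mem_nhdsWithin] with t ht
    exact (H.frame t ht).gradSize_eq_zero (by simp [qExplicit, hz]) (by simp [rExplicit, hz])
  · refine tendsto_atTop_mono' _ ?_
      (tendsto_norm_qExplicit_atTop hb hα0 (mt zc_eq_zero_iff.1 hxy))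
    filter_upwards [self_mem_nhdsWithin] with t ht
    exact (le_add_of_nonneg_right (norm_nonneg _)).trans
      ((H.frame t ht).norm_add_norm_le_gradSize x y)

end

theorem theorem4 (a b α : ℝ) (ha : 0 < a) (hb : b < 0) (hα : α ^ 2 = b ^ 2 / 16) :
    ∃ (s : ℝ → ℝ → ℝ → Fin 3 → ℝ) (G : ℝ → ℝ → ℝ → Matrix (Fin 2) (Fin 2) ℂ),
      IsSmoothSchrodingerMap (Iio (-a / b)) s ∧
      (∀ x y : ℝ,
        Tendsto (fun t => gradSize (s t) x y) (𝓝[<] (-a / b)) atTop ↔ (x, y) ≠ (0, 0)) ∧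
      IsGaugeTransform (Iio (-a / b)) (fun _ _ _ => 0) (qExplicit a b α) (rExplicit a b α)
        (uExplicit a b α) G s ∧
      ∀ t ∈ Iio (-a / b), ∀ x y : ℝ,
        ‖qExplicit a b α t x y‖ + ‖rExplicit a b α t x y‖ ≤ gradSize (s t) x y := by
  simpa only [setOf_add_mul_pos_of_neg a hb] using theorem4_general a b α hb.ne hα
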